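/- Let $\mathbb{D}$ be the open unit disc in $\mathbb{C}$ and let $H^2(\mathbb{D})$ be the Hardy space, that is, the Hilbert space of all functions $f(z)=\sum_{n\ge 0}a_nz^n$ on $\mathbb{D}$ with $\|f\|^2=\sum_{n\ge 0}|a_n|^2<\infty$. For a continuous linear operator $T$ on a topological vector space $X$, let $HC(T)$ be the set of hypercyclic vectors of $T$, i.e. of those $x\in X$ whose orbit $\{T^nx : n\ge 1\}$ is dense in $X$. An inner function is a bounded holomorphic function $\varphi$ on $\mathbb{D}$ whose radial limit $\lim_{r\to1^-}\varphi(re^{i\theta})$ exists and has modulus $1$ for almost every $\theta$. 1. Let $\varphi$ be a nonconstant inner function, and let $M_\varphi$ be the bounded operator $M_\varphi f=\varphi f$ on $H^2(\mathbb{D})$, with adjoint $M_\varphi^*$. Then the set of common hypercyclic vectors $\bigcap_{\lambda>1}HC(\lambda M_\varphi^*)$ ($\lambda$ real) is residual in $H^2(\mathbb{D})$; more precisely, it is a dense $G_\delta$ set. 2. In particular, $\varphi(z)=z$ is an inner function and, under the unitary identification of $f=\sum a_nz^n\in H^2(\mathbb{D})$ with $(a_n)_{n\ge0}\in\ell^2(\mathbb{N})$,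 the operator $M_z^*$ becomes the backward shift $B(a_0,a_1,a_2,\dots)=(a_1,a_2,a_3,\dots)$. Hence (Abakumov–Gordon) there is a vector $x\in\ell^2(\mathbb{N})$ which is hypercyclic for $\lambda B$ for every $\lambda>1$. -/

import Mathlib

open Complex Filter Topology MeasureTheory
open scoped Complex.UnitDisc

noncomputable section

/-! ### Hypercyclic vectors -/

/-- `HC(T)`: the set of hypercyclic vectors of `T`, that is, of the vectors `x` whose orbit
`{T ^ n x : n ≥ 1}` is dense. -/
def hypercyclicVectors {X : Type*} [AddCommGroup X] [Module ℂ X] [TopologicalSpace X]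
    (T : X →L[ℂ] X) : Set X :=
  {x | Dense {y : X | ∃ n : ℕ, 1 ≤ n ∧ y = (T ^ n) x}}

/-! ### The sequence space `ℓ²` and its backward shift -/

/-- `ℓ²(ℕ)` with complex entries. -/
abbrev EllTwo : Type := lp (fun _ : ℕ => ℂ) 2

theorem EllTwo.summable (a : EllTwo) : Summable fun n => ‖a n‖ ^ 2 := by
  simpa using (lp.memℓp a).summable (by simp)

theorem EllTwo.norm_sq (a : EllTwo) : ‖a‖ ^ 2 = ∑' n, ‖a n‖ ^ 2 := by
  simpa using lp.norm_rpow_eq_tsum (p := 2) (by simp) a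

theorem EllTwo.memlp {a : ℕ → ℂ} (h : Summable fun n => ‖a n‖ ^ 2) :
    Memℓp (E := fun _ : ℕ => ℂ) a 2 :=
  memℓp_gen (by simpa using h)

/-- The backward shift `(a₀, a₁, a₂, …) ↦ (a₁, a₂, a₃, …)` on `ℓ²`. -/
def backwardShift : EllTwo →L[ℂ] EllTwo :=
  LinearMap.mkContinuous
    { toFun := fun a => ⟨fun n => a (n + 1),
        EllTwo.memlp ((summable_nat_add_iff 1).2 a.summable)⟩
      map_add' := fun a b => by ext n; rfl
      map_smul' := fun c a => by ext n; rfl }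
    1 (fun a => by
      rw [one_mul]
      refine (sq_le_sq₀ (norm_nonneg _) (norm_nonneg _)).1 ?_
      rw [EllTwo.norm_sq, EllTwo.norm_sq, a.summable.tsum_eq_zero_add]
      exact le_add_of_nonneg_left (by positivity))

@[simp]
theorem backwardShift_apply (a : EllTwo) (n : ℕ) : backwardShift a n = a (n + 1) := rfl

/-! ### Power series on the disc -/

theorem EllTwo.norm_coeff_le (a : EllTwo) (n : ℕ) : ‖a n‖ ≤ ‖a‖ :=
  lp.norm_apply_le_norm (by simp) a n

theorem EllTwo.summable_mul_pow (a : EllTwo) {r : ℝ} (h0 : 0 ≤ r) (h1 : r < 1) :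
    Summable fun n => ‖a n‖ * r ^ n :=
  Summable.of_nonneg_of_le (fun n => by positivity)
    (fun n => mul_le_mul_of_nonneg_right (a.norm_coeff_le n) (by positivity))
    ((summable_geometric_of_lt_one h0 h1).mul_left ‖a‖)

theorem EllTwo.summable_powerSeries (a : EllTwo) {z : ℂ} (hz : ‖z‖ < 1) :
    Summable fun n => a n * z ^ n :=
  Summable.of_norm (by simpa using a.summable_mul_pow (norm_nonneg z) hz)

theorem EllTwo.differentiableOn_powerSeries (a : EllTwo) :
    DifferentiableOn ℂ (fun z => ∑' n, a n * z ^ n) (Metric.ball 0 1) := by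
  intro z hz
  rw [mem_ball_zero_iff] at hz
  obtain ⟨r, hzr, hr1⟩ := exists_between hz
  have h0 : 0 ≤ r := (norm_nonneg z).trans hzr.le
  have := differentiableOn_tsum_of_summable_norm (F := fun n (z : ℂ) => a n * z ^ n)
    (U := Metric.ball 0 r) (a.summable_mul_pow h0 hr1)
    (fun n => by fun_prop) Metric.isOpen_ball (fun n w hw => by
      rw [mem_ball_zero_iff] at hw
      rw [norm_mul, norm_pow]
      gcongr)
  exact ((this z (by simpa using hzr)).differentiableAt
    (Metric.isOpen_ball.mem_nhds (by simpa using hzr))).differentiableWithinAt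

instance fact_two_pi_pos : Fact (0 < 2 * Real.pi) := ⟨Real.two_pi_pos⟩

/-- Parseval's identity for an absolutely convergent trigonometric series without negative
frequencies. -/
theorem parseval_of_summable {c : ℕ → ℂ} (hc : Summable fun n => ‖c n‖)
    (F : C(AddCircle (2 * Real.pi), ℂ))
    (hF : ∀ x, HasSum (fun n : ℕ => c n * fourier (n : ℤ) x) (F x)) :
    HasSum (fun n => ‖c n‖ ^ 2) (∫ x, ‖F x‖ ^ 2 ∂AddCircle.haarAddCircle) := by
  classical
  have hv : Orthonormal ℂ (fun n : ℕ => fourierLp (T := 2 * Real.pi) 2 (n : ℤ)) :=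
    orthonormal_fourier.comp _ Nat.cast_injective
  have hsumC : HasSum (fun n : ℕ => c n • fourier (T := 2 * Real.pi) (n : ℤ)) F := by
    have hs : Summable (fun n : ℕ => c n • fourier (T := 2 * Real.pi) (n : ℤ)) :=
      Summable.of_norm (by simpa [norm_smul, fourier_norm] using hc)
    convert hs.hasSum
    ext x
    exact (hF x).unique (hs.hasSum.mapL (ContinuousMap.evalCLM ℂ x))
  have hsum := hsumC.mapL (ContinuousMap.toLp (E := ℂ) 2 AddCircle.haarAddCircle ℂ)
  simp only [map_smul] at hsum
  set x := ContinuousMap.toLp (E := ℂ) 2 (AddCircle.haarAddCircle (T := 2 * Real.pi)) ℂ F with hx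
  have hco : ∀ m : ℕ, inner ℂ (fourierLp (T := 2 * Real.pi) 2 (m : ℤ)) x = c m := by
    intro m
    refine (hsum.mapL (innerSL ℂ (fourierLp (T := 2 * Real.pi) 2 (m : ℤ)))).unique ?_
    convert! hasSum_ite_eq m (c m) using 1
    funext n
    change inner ℂ (fourierLp (T := 2 * Real.pi) 2 (m : ℤ))
      (c n • fourierLp (T := 2 * Real.pi) 2 (n : ℤ)) = _
    have := (orthonormal_iff_ite.1 hv) m n
    rw [inner_smul_right, this]
    by_cases hmn : n = m
    · simp [hmn]
    · simp [hmn, Ne.symm hmn]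
  have h2 := hsum.mapL (innerSL ℂ x)
  have h3 : HasSum (fun n => ((‖c n‖ ^ 2 : ℝ) : ℂ)) ((‖x‖ ^ 2 : ℝ) : ℂ) := by
    convert! h2 using 1
    · funext n
      change _ = inner ℂ x (c n • fourierLp (T := 2 * Real.pi) 2 (n : ℤ))
      rw [inner_smul_right, ← inner_conj_symm, hco, Complex.mul_conj, Complex.normSq_eq_norm_sq]
    · change _ = inner ℂ x x
      rw [inner_self_eq_norm_sq_to_K]
      simp
  have h4 := Complex.hasSum_ofReal.1 h3
  convert! h4 using 1
  have h5 := congr_arg RCLike.re (@L2.inner_def (AddCircle (2 * Real.pi)) ℂ ℂ _ _ _ _ _ x x)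
  rw [← integral_re] at h5
  · simp only [← norm_sq_eq_re_inner] at h5
    rw [h5]
    refine integral_congr_ae ?_
    filter_upwards [ContinuousMap.coeFn_toLp (E := ℂ) (p := 2) (𝕜 := ℂ)
      (AddCircle.haarAddCircle (T := 2 * Real.pi)) F] with t ht
    rw [hx, ht]
  · exact L2.integrable_inner x x

/-- If `|G| ≤ C |F|` on the circle of radius `r < 1` then the Taylor coefficients satisfy the
corresponding inequality. -/
theorem coeff_le_of_norm_le {a b : ℕ → ℂ} {C r : ℝ} (hr : 0 ≤ r)
    (ha : Summable fun n => ‖a n‖ * r ^ n) (hb : Summable fun n => ‖b n‖ * r ^ n)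
    (h : ∀ z : ℂ, ‖z‖ = r → ‖∑' n, b n * z ^ n‖ ≤ C * ‖∑' n, a n * z ^ n‖) :
    ∑' n, ‖b n * r ^ n‖ ^ 2 ≤ C ^ 2 * ∑' n, ‖a n * r ^ n‖ ^ 2
    ∧ (Summable fun n => ‖b n * r ^ n‖ ^ 2) := by
  have key : ∀ d : ℕ → ℂ, (Summable fun n => ‖d n‖ * r ^ n) →
      ∃ F : C(AddCircle (2 * Real.pi), ℂ),
        (∀ x, F x = ∑' n, d n * ((r : ℂ) * fourier (1 : ℤ) x) ^ n) ∧
        HasSum (fun n => ‖d n * (r : ℂ) ^ n‖ ^ 2) (∫ x, ‖F x‖ ^ 2 ∂AddCircle.haarAddCircle) := by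
    intro d hd
    have hd' : Summable fun n => ‖d n * (r : ℂ) ^ n‖ := by
      simpa [abs_of_nonneg hr] using hd
    have hs : Summable (fun n : ℕ =>
        (d n * (r : ℂ) ^ n) • fourier (T := 2 * Real.pi) (n : ℤ)) :=
      Summable.of_norm (by simpa [norm_smul, fourier_norm] using hd')
    have hs' : ∀ x, HasSum (fun n : ℕ => (d n * (r : ℂ) ^ n) * fourier (T := 2 * Real.pi) (n : ℤ) x)
        ((∑' n : ℕ, (d n * (r : ℂ) ^ n) • fourier (T := 2 * Real.pi) (n : ℤ)) x) := fun x =>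
      hs.hasSum.mapL (ContinuousMap.evalCLM ℂ x)
    refine ⟨_, fun x => ?_, parseval_of_summable hd' _ hs'⟩
    rw [← (hs' x).tsum_eq]
    refine tsum_congr fun n => ?_
    have : fourier (T := 2 * Real.pi) (n : ℤ) x = fourier (T := 2 * Real.pi) (1 : ℤ) x ^ n := by
      simp [fourier_apply, AddCircle.toCircle_nsmul]
    rw [this, mul_pow, mul_assoc]
  obtain ⟨F, hF, hFs⟩ := key a ha
  obtain ⟨G, hG, hGs⟩ := key b hb
  refine ⟨?_, hGs.summable⟩
  rw [hGs.tsum_eq, hFs.tsum_eq, ← integral_const_mul]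
  have hi : ∀ H : C(AddCircle (2 * Real.pi), ℂ),
      Integrable (fun x => ‖H x‖ ^ 2) AddCircle.haarAddCircle := fun H =>
    Continuous.integrable_of_hasCompactSupport (by fun_prop) (HasCompactSupport.of_compactSpace _)
  refine integral_mono (hi G) ((hi F).const_mul _) fun x => ?_
  have := h ((r : ℂ) * fourier (1 : ℤ) x) (by
    rw [norm_mul, fourier_apply, Circle.norm_coe, Complex.norm_real, Real.norm_of_nonneg hr, mul_one])
  rw [← hF, ← hG] at this
  change ‖G x‖ ^ 2 ≤ C ^ 2 * ‖F x‖ ^ 2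
  rw [← mul_pow]
  exact pow_le_pow_left₀ (norm_nonneg _) this 2

/-! ### The Hardy space `H²(𝔻)` -/

/-- The functions `f : 𝔻 → ℂ` of the form `f(z) = ∑ aₙ zⁿ` with `∑ |aₙ|² < ∞`. -/
def hardySubmodule : Submodule ℂ (𝔻 → ℂ) where
  carrier := {f | ∃ a : EllTwo, ∀ z : 𝔻, HasSum (fun n => a n * (z : ℂ) ^ n) (f z)}
  zero_mem' := ⟨0, fun z => by simp⟩
  add_mem' := by
    rintro f g ⟨a, ha⟩ ⟨b, hb⟩
    exact ⟨a + b, fun z => by simpa [add_mul] using (ha z).add (hb z)⟩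
  smul_mem' := by
    rintro c f ⟨a, ha⟩
    exact ⟨c • a, fun z => by simpa [mul_assoc] using (ha z).mul_left c⟩

/-- The Hardy space `H²(𝔻)`. It is a type of its own (and not the coercion of `hardySubmodule`),
because its topology is that of the norm `‖f‖² = ∑ |aₙ|²` and not that of pointwise convergence. -/
def HardySpace : Type := hardySubmodule

namespace HardySpace

instance : AddCommGroup HardySpace := inferInstanceAs (AddCommGroup hardySubmodule)

instance : Module ℂ HardySpace := inferInstanceAs (Module ℂ hardySubmodule)

instance : CoeFun HardySpace (fun _ => 𝔻 → ℂ) := ⟨fun f => f.1⟩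

@[ext]
theorem ext {f g : HardySpace} (h : ∀ z, f z = g z) : f = g := Subtype.ext (funext h)

@[simp] theorem add_apply (f g : HardySpace) (z : 𝔻) : (f + g) z = f z + g z := rfl

@[simp] theorem smul_apply (c : ℂ) (f : HardySpace) (z : 𝔻) : (c • f) z = c * f z := rfl

/-- The sequence of Taylor coefficients at `0` of `f`. -/
def coeff (f : HardySpace) : EllTwo := f.2.choose

theorem hasSum_coeff (f : HardySpace) (z : 𝔻) :
    HasSum (fun n => f.coeff n * (z : ℂ) ^ n) (f z) := f.2.choose_spec z

/-- The function `z ↦ ∑ aₙ zⁿ` of `H²(𝔻)`. -/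
def ofCoeff (a : EllTwo) : HardySpace :=
  ⟨fun z => ∑' n, a n * (z : ℂ) ^ n, a, fun z => (a.summable_powerSeries z.norm_lt_one).hasSum⟩

theorem coeff_unique {a b : EllTwo}
    (h : ∀ z : 𝔻, ∑' n, a n * (z : ℂ) ^ n = ∑' n, b n * (z : ℂ) ^ n) : a = b := by
  have hsm : ∀ d : EllTwo, Summable fun n => ‖d n‖ * (1 / 2 : ℝ) ^ n := fun d =>
    d.summable_mul_pow (by norm_num) (by norm_num)
  obtain ⟨h1, h2⟩ := coeff_le_of_norm_le (a := fun _ => 0) (b := fun n => (a - b) n) (C := 0)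
    (r := 1 / 2) (by norm_num) (by simp) (hsm (a - b)) (by
      intro z hz
      have hz' : ‖z‖ < 1 := by rw [hz]; norm_num
      have h3 := (a.summable_powerSeries hz').tsum_sub (b.summable_powerSeries hz')
      have h4 := h (UnitDisc.mk z hz')
      rw [UnitDisc.coe_mk] at h4
      have h5 : ∑' n, (a - b) n * z ^ n = 0 := by
        rw [h4, sub_self] at h3
        rw [← h3]
        exact tsum_congr fun n => by simp [sub_mul]
      rw [h5]
      simp)
  have h6 : ∀ n, ‖(a - b) n * ((1 / 2 : ℝ) : ℂ) ^ n‖ ^ 2 = 0 := fun n =>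
    le_antisymm ((h2.le_tsum n fun _ _ => by positivity).trans (by simpa using h1)) (by positivity)
  ext n
  have h7 := h6 n
  simp [sub_eq_zero] at h7
  exact h7

/-- The Taylor coefficients, as a linear bijection of `H²(𝔻)` onto `ℓ²`. -/
def taylor : HardySpace ≃ₗ[ℂ] EllTwo where
  toFun := coeff
  invFun := ofCoeff
  map_add' f g := coeff_unique fun z => by
    rw [(hasSum_coeff _ z).tsum_eq]
    simpa [add_mul] using ((hasSum_coeff f z).add (hasSum_coeff g z)).tsum_eq.symm
  map_smul' c f := coeff_unique fun z => by
    rw [(hasSum_coeff _ z).tsum_eq]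
    simpa [mul_assoc] using ((hasSum_coeff f z).mul_left c).tsum_eq.symm
  left_inv f := by ext z; exact (hasSum_coeff f z).tsum_eq
  right_inv a := coeff_unique fun z => (hasSum_coeff (ofCoeff a) z).tsum_eq

theorem hasSum_taylor (f : HardySpace) (z : 𝔻) :
    HasSum (fun n => taylor f n * (z : ℂ) ^ n) (f z) := hasSum_coeff f z

instance : NormedAddCommGroup HardySpace :=
  NormedAddCommGroup.induced HardySpace EllTwo taylor taylor.injective

/-- The inner product `⟪f, g⟫ = ∑ conj (aₙ) bₙ` of Taylor coefficients. -/
instance : InnerProductSpace ℂ HardySpace where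
  norm_smul_le c f := by
    change ‖taylor (c • f)‖ ≤ ‖c‖ * ‖taylor f‖
    rw [map_smul, norm_smul]
  inner f g := inner ℂ (taylor f) (taylor g)
  norm_sq_eq_re_inner f := norm_sq_eq_re_inner (𝕜 := ℂ) (taylor f)
  conj_inner_symm f g := inner_conj_symm (taylor f) (taylor g)
  add_left f g h := by
    change inner ℂ (taylor (f + g)) (taylor h) = _
    rw [map_add, inner_add_left]
  smul_left f g c := by
    change inner ℂ (taylor (c • f)) (taylor g) = _
    rw [map_smul, inner_smul_left]

theorem inner_def (f g : HardySpace) : inner ℂ f g = inner ℂ (taylor f) (taylor g) := rfl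

theorem norm_def (f : HardySpace) : ‖f‖ = ‖taylor f‖ := rfl

/-- The Taylor coefficients, as a unitary operator of `H²(𝔻)` onto `ℓ²`. -/
def taylorIsometry : HardySpace ≃ₗᵢ[ℂ] EllTwo := ⟨taylor, fun _ => rfl⟩

instance : CompleteSpace HardySpace :=
  taylorIsometry.symm.toIsometryEquiv.completeSpace_iff.1 inferInstance

end HardySpace

/-! ### Bounded holomorphic functions, inner functions and multipliers -/

/-- `φ ∈ H^∞(𝔻)`: `φ` is holomorphic and bounded on the open unit disc. -/
def IsBoundedHolomorphic (φ : ℂ → ℂ) : Prop :=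
  DifferentiableOn ℂ φ (Metric.ball 0 1) ∧ ∃ C : ℝ, ∀ z ∈ Metric.ball (0 : ℂ) 1, ‖φ z‖ ≤ C

/-- Inner functions: bounded holomorphic functions on the disc whose radial limits exist and have
modulus one at almost every point of the unit circle. -/
structure IsInner (φ : ℂ → ℂ) : Prop where
  bounded : IsBoundedHolomorphic φ
  radial : ∀ᵐ θ : ℝ, ∃ w : ℂ, ‖w‖ = 1 ∧
    Tendsto (fun r : ℝ => φ (r * exp (θ * I))) (𝓝[<] 1) (𝓝 w)

/-- `φ f` lies in `H²(𝔻)`, with `‖φ f‖ ≤ C ‖f‖` if `|φ| ≤ C` on the disc. -/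
theorem HardySpace.exists_mul {φ : ℂ → ℂ} (hφ : DifferentiableOn ℂ φ (Metric.ball 0 1))
    {C : ℝ} (hC : ∀ z ∈ Metric.ball (0 : ℂ) 1, ‖φ z‖ ≤ C) (f : HardySpace) :
    ∃ g : HardySpace, (∀ z : 𝔻, g z = φ z * f z) ∧ ‖g‖ ≤ C * ‖f‖ := by
  have hF := f.coeff.differentiableOn_powerSeries
  have hC0 : 0 ≤ C := (norm_nonneg _).trans (hC 0 (by simp))
  have hdiff := hφ.mul hF
  set b : ℕ → ℂ := fun n => (n.factorial : ℂ)⁻¹ *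
    iteratedDeriv n (φ * fun z => ∑' n, f.coeff n * z ^ n) 0 with hb
  have hsum : ∀ z : ℂ, ‖z‖ < 1 →
      HasSum (fun n => b n * z ^ n) (φ z * ∑' n, f.coeff n * z ^ n) := by
    intro z hz
    have h := hasSum_taylorSeries_on_ball (c := (0 : ℂ)) (r := 1)
      (f := φ * fun z => ∑' n, f.coeff n * z ^ n) (by simpa using hdiff) (z := z) (by simpa using hz)
    convert! h using 1
    funext n
    simp only [hb, sub_zero, smul_eq_mul]
    ring
  have hbs : ∀ r : ℝ, 0 ≤ r → r < 1 → Summable fun n => ‖b n‖ * r ^ n := by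
    intro r h0 h1
    have := (hsum (r : ℂ) (by simpa [abs_of_nonneg h0] using h1)).summable.norm
    simpa [abs_of_nonneg h0] using this
  have hfin : ∀ s : Finset ℕ, ∑ n ∈ s, ‖b n‖ ^ 2 ≤ (C * ‖f‖) ^ 2 := by
    intro s
    have hlim : Tendsto (fun r : ℝ => ∑ n ∈ s, ‖b n * (r : ℂ) ^ n‖ ^ 2) (𝓝[<] 1)
        (𝓝 (∑ n ∈ s, ‖b n‖ ^ 2)) := by
      have hcont : Continuous (fun r : ℝ => ∑ n ∈ s, ‖b n * (r : ℂ) ^ n‖ ^ 2) := by fun_prop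
      simpa using (hcont.tendsto 1).mono_left nhdsWithin_le_nhds
    refine le_of_tendsto hlim ?_
    filter_upwards [Ioo_mem_nhdsLT (zero_lt_one (α := ℝ))] with r hr
    obtain ⟨h1, h2⟩ := coeff_le_of_norm_le (a := fun n => f.coeff n) (b := b) (C := C) hr.1.le
      (f.coeff.summable_mul_pow hr.1.le hr.2) (hbs r hr.1.le hr.2) (by
        intro z hz
        have hz1 : ‖z‖ < 1 := hz.trans_lt hr.2
        rw [(hsum z hz1).tsum_eq, norm_mul]
        exact mul_le_mul_of_nonneg_right (hC z (by simpa using hz1)) (norm_nonneg _))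
    refine (h2.sum_le_tsum s fun _ _ => by positivity).trans (h1.trans ?_)
    rw [mul_pow]
    refine mul_le_mul_of_nonneg_left ?_ (by positivity)
    have h3 : ∀ n, ‖f.coeff n * (r : ℂ) ^ n‖ ^ 2 ≤ ‖f.coeff n‖ ^ 2 := by
      intro n
      refine pow_le_pow_left₀ (norm_nonneg _) ?_ 2
      rw [norm_mul]
      refine mul_le_of_le_one_right (norm_nonneg _) ?_
      rw [norm_pow, Complex.norm_real, Real.norm_of_nonneg hr.1.le]
      exact pow_le_one₀ hr.1.le hr.2.le
    have h4 : ‖f‖ ^ 2 = ∑' n, ‖f.coeff n‖ ^ 2 := f.coeff.norm_sq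
    rw [h4]
    exact (Summable.of_nonneg_of_le (fun _ => by positivity) h3 f.coeff.summable).tsum_le_tsum h3
      f.coeff.summable
  have hbl : Summable fun n => ‖b n‖ ^ 2 :=
    summable_of_sum_le (fun _ => by positivity) hfin
  set B : EllTwo := ⟨b, EllTwo.memlp hbl⟩ with hB
  refine ⟨HardySpace.ofCoeff B, fun z => ?_, ?_⟩
  · rw [← (f.hasSum_coeff z).tsum_eq]
    exact (hsum z z.norm_lt_one).tsum_eq
  · have h5 : HardySpace.taylor (HardySpace.ofCoeff B) = B :=
      HardySpace.taylor.apply_symm_apply B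
    rw [HardySpace.norm_def, h5]
    refine (sq_le_sq₀ (norm_nonneg _) (by positivity)).1 ?_
    rw [EllTwo.norm_sq]
    exact hbl.tsum_le_of_sum_le hfin

/-- The multiplication operator `M_φ f = φ f` on `H²(𝔻)`. -/
def multiplier (φ : ℂ → ℂ) (hφ : IsBoundedHolomorphic φ) : HardySpace →L[ℂ] HardySpace :=
  LinearMap.mkContinuous
    { toFun := fun f => ⟨fun z => φ z * f z, by
        obtain ⟨C, hC⟩ := hφ.2
        obtain ⟨g, hg, -⟩ := HardySpace.exists_mul hφ.1 hC f
        exact (funext hg : (g : 𝔻 → ℂ) = _) ▸ g.2⟩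
      map_add' := fun f g => HardySpace.ext fun z => mul_add _ _ _
      map_smul' := fun c f => HardySpace.ext fun z => mul_left_comm _ _ _ }
    hφ.2.choose (fun f => by
      obtain ⟨g, hg, hle⟩ := HardySpace.exists_mul hφ.1 hφ.2.choose_spec f
      convert! hle using 2
      exact HardySpace.ext fun z => (hg z).symm)

@[simp]
theorem multiplier_apply (φ : ℂ → ℂ) (hφ : IsBoundedHolomorphic φ) (f : HardySpace) (z : 𝔻) :
    multiplier φ hφ f z = φ z * f z := rfl

end

/-! Write `M` for multiplication by `φ` and `T` for its adjoint. Since `|φ| = 1` almost everywhere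
on the circle, `M` is an isometry (`IsInner.norm_multiplier`), so `T M = 1`. Since `φ` is not
constant, `|φ| < 1` on the disc, so the ranges of the `M ^ n` meet only in `0`; by duality the union
of the kernels of the `T ^ n` is dense (`dense_setOf_adjoint_pow_eq_zero`).

The rest is a Baire argument using only these facts. For `[a, b]` inside `(1, ∞)` and `V` open,
`uniformVisit T a b V` is open by compactness, and the crux is its density (`dense_uniformVisit`).
Take `x`, `y` killed by a power of `T`, with `y` in `V`, and perturb `x` by `∑ λ_j ^ (-(j+1)N) M ^
((j+1)N) y`. For `λ` in `[λ_j, λ_{j+1}]` the operator `(λ T) ^ ((j+1)N)` kills `x` and the earlier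
terms, sends the `j`-th term to `(λ/λ_j) ^ ((j+1)N) y`, and leaves a tail of order `a ^ (-N)`.
Closeness to `y` allows `log (λ_{j+1}/λ_j)` of size `δ/((j+1)N)`; the harmonic series diverges, so
finitely many `λ_j` cover `[a, b]`.

For `φ(z) = z`, Taylor coefficients turn `T` into the backward shift and transport the common vector
to `ℓ²`. -/

/-! ### Common hypercyclic vectors of the multiples of a left inverse of a contraction -/

section Abstract

variable {E : Type*} [NormedAddCommGroup E] [NormedSpace ℂ E]

/-- `λ_j`, where `λ_0 = a` and `λ_{j+1} = λ_j exp (δ / ((j + 1) N))`. -/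
noncomputable def ratioPartition (a δ : ℝ) (N j : ℕ) : ℝ :=
  a * Real.exp (∑ i ∈ Finset.range j, δ / ((i + 1) * N))

theorem ratioPartition_zero (a δ : ℝ) (N : ℕ) : ratioPartition a δ N 0 = a := by
  simp [ratioPartition]

theorem ratioPartition_succ (a δ : ℝ) (N j : ℕ) :
    ratioPartition a δ N (j + 1) = ratioPartition a δ N j * Real.exp (δ / ((j + 1) * N)) := by
  rw [ratioPartition, Finset.sum_range_succ, Real.exp_add, ← mul_assoc, ratioPartition]

theorem ratioPartition_mono {a δ : ℝ} (ha : 0 ≤ a) (hδ : 0 ≤ δ) (N : ℕ) :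
    Monotone (ratioPartition a δ N) := by
  refine monotone_nat_of_le_succ fun j => ?_
  rw [ratioPartition_succ]
  refine le_mul_of_one_le_right (mul_nonneg ha (Real.exp_pos _).le) (Real.one_le_exp ?_)
  positivity

/-- Divergence of the harmonic series: this is what lets finitely many nodes pass any given `b`. -/
theorem tendsto_ratioPartition {a δ : ℝ} (ha : 0 < a) (hδ : 0 < δ) {N : ℕ} (hN : 0 < N) :
    Tendsto (ratioPartition a δ N) atTop atTop := by
  refine Tendsto.const_mul_atTop ha (Real.tendsto_exp_atTop.comp ?_)
  have hN' : (0 : ℝ) < N := by exact_mod_cast hN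
  have h := Real.tendsto_sum_range_one_div_nat_succ_atTop.const_mul_atTop (div_pos hδ hN')
  refine h.congr fun n => ?_
  rw [Finset.mul_sum]
  refine Finset.sum_congr rfl fun i _ => ?_
  field_simp

theorem sum_pow_le_div_one_sub {q : ℝ} (h0 : 0 ≤ q) (h1 : q < 1) (n : ℕ) :
    ∑ k ∈ Finset.range n, q ^ (k + 1) ≤ q / (1 - q) := by
  simp_rw [pow_succ']
  rw [← Finset.mul_sum, div_eq_mul_inv, ← tsum_geometric_of_lt_one h0 h1]
  exact mul_le_mul_of_nonneg_left
    ((summable_geometric_of_lt_one h0 h1).sum_le_tsum _ fun _ _ => by positivity) h0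

/-! ### Powers of an operator and of a contractive right inverse -/

theorem pow_apply_eq_zero_of_le {T : E →L[ℂ] E} {x : E} {m n : ℕ} (h : m ≤ n)
    (hx : (T ^ m) x = 0) : (T ^ n) x = 0 := by
  obtain ⟨k, rfl⟩ := Nat.exists_eq_add_of_le' h
  rw [pow_add, mul_apply_eq_comp, hx, map_zero]

theorem norm_pow_apply_le {M : E →L[ℂ] E} (hM : ∀ x, ‖M x‖ ≤ ‖x‖) (n : ℕ) (x : E) :
    ‖(M ^ n) x‖ ≤ ‖x‖ := by
  induction n with
  | zero => simp
  | succ n ih => rw [pow_succ', mul_apply_eq_comp]; exact (hM _).trans ih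

theorem pow_mul_pow_of_mul_eq_one {R : Type*} [Monoid R] {T M : R} (h : T * M = 1) (n : ℕ) :
    T ^ n * M ^ n = 1 := by
  induction n with
  | zero => simp
  | succ n ih => rw [pow_succ, pow_succ', mul_assoc, ← mul_assoc T, h, one_mul, ih]

theorem pow_apply_pow_apply {T M : E →L[ℂ] E} (hTM : T * M = 1) {m n : ℕ} (h : m ≤ n) (y : E) :
    (T ^ m) ((M ^ n) y) = (M ^ (n - m)) y := by
  rw [← mul_apply_eq_comp]
  conv_lhs => rw [← Nat.add_sub_of_le h, pow_add, ← mul_assoc, pow_mul_pow_of_mul_eq_one hTM,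
    one_mul]

theorem pow_apply_pow_apply' {T M : E →L[ℂ] E} (hTM : T * M = 1) {m n : ℕ} (h : n ≤ m) (y : E) :
    (T ^ m) ((M ^ n) y) = (T ^ (m - n)) y := by
  rw [← mul_apply_eq_comp]
  conv_lhs => rw [← Nat.sub_add_cancel h, pow_add, mul_assoc, pow_mul_pow_of_mul_eq_one hTM,
    mul_one]

/-- The perturbation `∑_{j<J} λ_j^{-(j+1)N} M^{(j+1)N} y`. -/
noncomputable def approximant (M : E →L[ℂ] E) (μ : ℕ → ℝ) (N J : ℕ) (y : E) : E :=
  ∑ i ∈ Finset.range J, ((((μ i)⁻¹) ^ ((i + 1) * N) : ℝ) : ℂ) • (M ^ ((i + 1) * N)) y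

theorem norm_real_smul (c : ℝ) (hc : 0 ≤ c) (x : E) : ‖(c : ℂ) • x‖ = c * ‖x‖ := by
  rw [norm_smul, Complex.norm_real, Real.norm_of_nonneg hc]

/-- The bound is independent of `J`, which matters because the number of nodes needed to cover `[a,
b]` depends on `N`. -/
theorem norm_approximant_le {M : E →L[ℂ] E} (hM : ∀ x, ‖M x‖ ≤ ‖x‖) {a : ℝ} (ha : 1 < a)
    {μ : ℕ → ℝ} (hμ : ∀ i, a ≤ μ i) {N : ℕ} (hN : 0 < N) (J : ℕ) (y : E) :
    ‖approximant M μ N J y‖ ≤ (a⁻¹ ^ N / (1 - a⁻¹ ^ N)) * ‖y‖ := by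
  have ha0 : 0 < a := zero_lt_one.trans ha
  refine (norm_sum_le _ _).trans ?_
  refine le_trans ?_ (mul_le_mul_of_nonneg_right (sum_pow_le_div_one_sub (by positivity)
    (pow_lt_one₀ (by positivity) (inv_lt_one_of_one_lt₀ ha) hN.ne') J) (norm_nonneg y))
  rw [Finset.sum_mul]
  refine Finset.sum_le_sum fun i _ => ?_
  have hi : 0 < μ i := ha0.trans_le (hμ i)
  rw [norm_real_smul _ (by positivity), ← pow_mul, mul_comm N]
  gcongr
  · exact hμ i
  · exact norm_pow_apply_le hM _ _

theorem norm_smul_pow_approximant_sub_le {T M : E →L[ℂ] E} (hTM : T * M = 1)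
    (hM : ∀ x, ‖M x‖ ≤ ‖x‖) {a lam ε : ℝ} (ha : 1 < a) {μ : ℕ → ℝ} (hμa : ∀ i, a ≤ μ i)
    (hμ : Monotone μ) {N J j : ℕ} (hN : 0 < N) (hj : j < J) (h1 : μ j ≤ lam)
    (h2 : lam ≤ μ (j + 1)) (hε : (lam / μ j) ^ ((j + 1) * N) - 1 ≤ ε) {y : E}
    (hy : (T ^ N) y = 0) :
    ‖((lam : ℂ) ^ ((j + 1) * N)) • (T ^ ((j + 1) * N)) (approximant M μ N J y) - y‖ ≤
      ε * ‖y‖ + (a⁻¹ ^ N / (1 - a⁻¹ ^ N)) * ‖y‖ := by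
  have ha0 : 0 < a := zero_lt_one.trans ha
  have hμ0 : ∀ i, 0 < μ i := fun i => ha0.trans_le (hμa i)
  have hl0 : 0 < lam := (hμ0 j).trans_le h1
  set n := (j + 1) * N with hn
  set t : ℕ → E := fun i => ((lam : ℂ) ^ n) • (T ^ n)
    (((((μ i)⁻¹) ^ ((i + 1) * N) : ℝ) : ℂ) • (M ^ ((i + 1) * N)) y) with ht
  have hsum : ((lam : ℂ) ^ n) • (T ^ n) (approximant M μ N J y) = ∑ i ∈ Finset.range J, t i := by
    rw [approximant, map_sum, Finset.smul_sum]
  -- Earlier blocks leave at least `N` surplus powers of `T` on `y`, and `T ^ N` already kills `y`.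
  have hlow : ∀ i ∈ Finset.range j, t i = 0 := by
    intro i hi
    have hij : i < j := Finset.mem_range.1 hi
    have hle : (i + 1) * N + N ≤ n := by
      rw [hn, ← Nat.succ_mul]
      exact Nat.mul_le_mul_right _ (by omega)
    have : (T ^ n) ((M ^ ((i + 1) * N)) y) = 0 := by
      rw [pow_apply_pow_apply' hTM (by omega)]
      exact pow_apply_eq_zero_of_le (by omega) hy
    simp only [ht, map_smul, this, smul_zero]
  have hmid : t j - y = (((lam / μ j) ^ n - 1 : ℝ) : ℂ) • y := by
    simp only [ht, map_smul]
    rw [pow_apply_pow_apply hTM le_rfl, Nat.sub_self, pow_zero, one_apply_eq_self,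
      smul_smul]
    push_cast
    rw [sub_smul, one_smul, div_eq_mul_inv, mul_pow]
  -- As `lam ≤ μ i`, the factor `(lam / μ i) ^ n` is at most `1`; what remains is `μ i` to the power
  -- `-(k + 1) * N`, the source of the geometric tail.
  have hhigh : ∀ k, ‖t (j + 1 + k)‖ ≤ (a⁻¹ ^ N) ^ (k + 1) * ‖y‖ := by
    intro k
    set i := j + 1 + k with hi
    have hle : (i + 1) * N = n + (k + 1) * N := by rw [hn, hi]; ring
    have hlam : lam ≤ μ i := h2.trans (hμ (by omega))
    simp only [ht, map_smul]
    rw [pow_apply_pow_apply hTM (by omega), smul_smul, ← Complex.ofReal_pow, ← Complex.ofReal_mul,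
      norm_real_smul _ (mul_nonneg (by positivity) (pow_nonneg (inv_pos.2 (hμ0 i)).le _))]
    refine mul_le_mul ?_ (norm_pow_apply_le hM _ _) (norm_nonneg _) (by positivity)
    rw [hle, pow_add, ← mul_assoc, ← mul_pow, ← pow_mul, mul_comm N]
    refine (mul_le_of_le_one_left (pow_nonneg (inv_pos.2 (hμ0 i)).le _) ?_).trans ?_
    · exact pow_le_one₀ (mul_nonneg hl0.le (inv_pos.2 (hμ0 i)).le)
        (by rw [← div_eq_mul_inv]; exact (div_le_one (hμ0 i)).2 hlam)
    · have := hμa i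
      have := hμ0 i
      gcongr
  have hsplit : ((lam : ℂ) ^ n) • (T ^ n) (approximant M μ N J y) - y =
      (t j - y) + ∑ k ∈ Finset.range (J - (j + 1)), t (j + 1 + k) := by
    rw [hsum, ← Finset.sum_range_add_sum_Ico _ (show j + 1 ≤ J from hj), Finset.sum_range_succ,
      Finset.sum_eq_zero hlow, zero_add, Finset.sum_Ico_eq_sum_range]
    abel
  rw [hsplit]
  refine (norm_add_le _ _).trans (add_le_add ?_ ?_)
  · rw [hmid, norm_real_smul]
    · gcongr
    · rw [sub_nonneg]
      exact one_le_pow₀ ((one_le_div (hμ0 j)).2 h1)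
  · refine (norm_sum_le _ _).trans ((Finset.sum_le_sum fun k _ => hhigh k).trans ?_)
    rw [← Finset.sum_mul]
    exact mul_le_mul_of_nonneg_right (sum_pow_le_div_one_sub (by positivity)
      (pow_lt_one₀ (by positivity) (inv_lt_one_of_one_lt₀ ha) hN.ne') _) (norm_nonneg y)

/-- The vectors `x` such that, for every `λ` in `[a, b]`, some `(λ T)^n x` with `n ≥ 1` is in `V`. -/
def uniformVisit (T : E →L[ℂ] E) (a b : ℝ) (V : Set E) : Set E :=
  {x | ∀ lam ∈ Set.Icc a b, ∃ n : ℕ, 1 ≤ n ∧ (((lam : ℂ) • T) ^ n) x ∈ V}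

theorem isOpen_uniformVisit (T : E →L[ℂ] E) (a b : ℝ) {V : Set E} (hV : IsOpen V) :
    IsOpen (uniformVisit T a b V) := by
  refine isOpen_iff_mem_nhds.2 fun x hx => ?_
  -- The exponent found for one `lam` works for all nearby pairs (vector, parameter); compactness
  -- then yields a single neighbourhood of `x`.
  refine isCompact_Icc.eventually_forall_of_forall_eventually fun lam hlam => ?_
  obtain ⟨n, hn, hnV⟩ := hx lam hlam
  have hc : Continuous fun p : E × ℝ => (((p.2 : ℂ) • T) ^ n) p.1 := by
    simp_rw [smul_pow, smul_apply]
    fun_prop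
  filter_upwards [(hV.preimage hc).mem_nhds hnV] with p hp
  exact ⟨n, hn, hp⟩

theorem dense_uniformVisit {T M : E →L[ℂ] E} (hTM : T * M = 1) (hM : ∀ x, ‖M x‖ ≤ ‖x‖)
    (hT : Dense {x : E | ∃ n, (T ^ n) x = 0}) {a : ℝ} (ha : 1 < a) (b : ℝ) {V : Set E}
    (hV : IsOpen V) (hVne : V.Nonempty) : Dense (uniformVisit T a b V) := by
  have ha0 : 0 < a := zero_lt_one.trans ha
  refine dense_iff_inter_open.2 fun U hU hUne => ?_
  obtain ⟨x, hxU, p, hx⟩ := hT.inter_open_nonempty U hU hUne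
  obtain ⟨y, hyV, m, hy⟩ := hT.inter_open_nonempty V hV hVne
  obtain ⟨ε₁, hε₁, hU'⟩ := Metric.isOpen_iff.1 hU x hxU
  obtain ⟨ε₂, hε₂, hV'⟩ := Metric.isOpen_iff.1 hV y hyV
  have hq : Tendsto (fun N : ℕ => (a⁻¹ ^ N / (1 - a⁻¹ ^ N)) * ‖y‖) atTop (𝓝 0) := by
    have h := tendsto_pow_atTop_nhds_zero_of_lt_one (inv_pos.2 ha0).le (inv_lt_one_of_one_lt₀ ha)
    simpa using (h.div (h.const_sub 1) (by simp)).mul_const ‖y‖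
  have hd : Tendsto (fun δ : ℝ => (Real.exp δ - 1) * ‖y‖) (𝓝[>] 0) (𝓝 0) := by
    have hc : Continuous fun δ : ℝ => (Real.exp δ - 1) * ‖y‖ := by fun_prop
    simpa using (hc.tendsto 0).mono_left nhdsWithin_le_nhds
  -- `exp δ - 1` bounds the relative error of the diagonal term whatever `N` is, so `δ` can be fixed
  -- before `N`.
  obtain ⟨δ, hδ, hδ0⟩ := ((hd.eventually_lt_const (half_pos hε₂)).and
    self_mem_nhdsWithin).exists
  replace hδ0 : 0 < δ := hδ0
  -- Besides making the perturbation and the tail small, `N ≥ p` and `N ≥ m` ensure that `T ^ N`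
  -- kills both `x` and `y`.
  obtain ⟨N, hN1, hN2, hNp, hNm, hN⟩ := ((hq.eventually_lt_const hε₁).and
    ((hq.eventually_lt_const (half_pos hε₂)).and ((eventually_ge_atTop p).and
    ((eventually_ge_atTop m).and (eventually_gt_atTop 0))))).exists
  set μ := ratioPartition a δ N with hμ
  have hmono : Monotone μ := ratioPartition_mono ha0.le hδ0.le N
  have hμ0 : μ 0 = a := ratioPartition_zero a δ N
  have hμa : ∀ i, a ≤ μ i := fun i => hμ0 ▸ hmono (Nat.zero_le i)
  obtain ⟨J, hJ⟩ := ((tendsto_ratioPartition ha0 hδ0 hN).eventually_gt_atTop b).exists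
  refine ⟨x + approximant M μ N J y, hU' ?_, fun lam hlam => ?_⟩
  · rw [mem_ball_iff_norm, add_sub_cancel_left]
    exact (norm_approximant_le hM ha hμa hN J y).trans_lt hN1
  · obtain ⟨j, hjJ, hj1, hj2⟩ : ∃ j, j < J ∧ μ j ≤ lam ∧ lam < μ (j + 1) := by
      classical
      -- The first node beyond `lam` has index `j + 1`; it is not node `0`, because `μ 0 = a ≤ lam`.
      have hex : ∃ j, lam < μ j := ⟨J, hlam.2.trans_lt hJ⟩
      have hne : Nat.find hex ≠ 0 := fun h0 => by
        have := Nat.find_spec hex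
        rw [h0, hμ0] at this
        exact absurd hlam.1 this.not_ge
      obtain ⟨j, hj⟩ := Nat.exists_eq_succ_of_ne_zero hne
      have hle : Nat.find hex ≤ J := Nat.find_min' hex (hlam.2.trans_lt hJ)
      exact ⟨j, by omega, not_lt.1 (Nat.find_min hex (by omega)), Nat.succ_eq_add_one j ▸ hj ▸ Nat.find_spec hex⟩
    have hμj : 0 < μ j := ha0.trans_le (hμa j)
    refine ⟨(j + 1) * N, Nat.mul_pos j.succ_pos hN, hV' ?_⟩
    have hx0 : (T ^ ((j + 1) * N)) x = 0 :=
      pow_apply_eq_zero_of_le (hNp.trans (Nat.le_mul_of_pos_left N j.succ_pos)) hx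
    rw [mem_ball_iff_norm, smul_pow, smul_apply, map_add, hx0, zero_add]
    refine (norm_smul_pow_approximant_sub_le hTM hM ha hμa hmono hN hjJ hj1 hj2.le
      (ε := Real.exp δ - 1) ?_ (pow_apply_eq_zero_of_le hNm hy)).trans_lt (by linarith)
    refine sub_le_sub_right ?_ 1
    have hNR : (0 : ℝ) < N := by exact_mod_cast hN
    calc (lam / μ j) ^ ((j + 1) * N) ≤ Real.exp (δ / ((j + 1) * N)) ^ ((j + 1) * N) := by
          refine pow_le_pow_left₀ (div_nonneg (hμj.le.trans hj1) hμj.le) ?_ _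
          rw [div_le_iff₀' hμj, ← ratioPartition_succ]
          exact hj2.le
      _ = Real.exp δ := by
          rw [← Real.exp_nat_mul]
          congr 1
          push_cast
          field_simp

/-! ### Baire category -/

open TopologicalSpace in
theorem iInter_hypercyclicVectors_eq [SecondCountableTopology E] (T : E →L[ℂ] E) :
    (⋂ (lam : ℝ) (_ : 1 < lam), hypercyclicVectors ((lam : ℂ) • T)) =
      ⋂ p : ℕ × {V // V ∈ countableBasis E},
        uniformVisit T (1 + 1 / ((p.1 : ℝ) + 1)) (p.1 + 1) p.2 := by
  ext x
  simp only [Set.mem_iInter]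
  constructor
  · rintro h ⟨k, V, hV⟩ lam hlam
    have hlam1 : 1 < lam := lt_of_lt_of_le (lt_add_of_pos_right 1 (by positivity)) hlam.1
    obtain ⟨-, hzV, n, hn, rfl⟩ := (h lam hlam1).inter_open_nonempty V
      (isOpen_of_mem_countableBasis hV) (nonempty_of_mem_countableBasis hV)
    exact ⟨n, hn, hzV⟩
  · intro h lam hlam
    refine (isBasis_countableBasis E).dense_iff.2 fun V hV _ => ?_
    -- The intervals `[1 + 1/(k+1), k+1]` exhaust `(1, ∞)`; the one for `k = 0` is empty, which is
    -- harmless.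
    obtain ⟨k, hk1, hk2⟩ : ∃ k : ℕ, 1 + 1 / ((k : ℝ) + 1) ≤ lam ∧ lam ≤ k + 1 := by
      have h1 := (tendsto_one_div_add_atTop_nhds_zero_nat (𝕜 := ℝ)).eventually_lt_const
        (sub_pos.2 hlam)
      obtain ⟨k, hk1, hk2⟩ := (h1.and (tendsto_natCast_atTop_atTop.eventually_ge_atTop lam)).exists
      exact ⟨k, by linarith, by linarith⟩
    obtain ⟨n, hn, hnV⟩ := h (k, ⟨V, hV⟩) lam ⟨hk1, hk2⟩
    exact ⟨_, hnV, n, hn, rfl⟩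

open TopologicalSpace in
/-- If `T` is a left inverse of a contraction and its generalised kernel is dense, then the set of
common hypercyclic vectors of the operators `λ T`, `λ > 1`, is a dense `Gδ` set. -/
theorem isGδ_and_dense_iInter_hypercyclicVectors [CompleteSpace E] [SecondCountableTopology E]
    {T M : E →L[ℂ] E} (hTM : T * M = 1) (hM : ∀ x, ‖M x‖ ≤ ‖x‖)
    (hT : Dense {x : E | ∃ n, (T ^ n) x = 0}) :
    IsGδ (⋂ (lam : ℝ) (_ : 1 < lam), hypercyclicVectors ((lam : ℂ) • T)) ∧
      Dense (⋂ (lam : ℝ) (_ : 1 < lam), hypercyclicVectors ((lam : ℂ) • T)) := by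
  rw [iInter_hypercyclicVectors_eq]
  have : Countable {V // V ∈ countableBasis E} := (countable_countableBasis E).to_subtype
  have ho : ∀ p : ℕ × {V // V ∈ countableBasis E},
      IsOpen (uniformVisit T (1 + 1 / ((p.1 : ℝ) + 1)) (p.1 + 1) p.2) := fun p =>
    isOpen_uniformVisit T _ _ (isOpen_of_mem_countableBasis p.2.2)
  exact ⟨IsGδ.iInter fun p => (ho p).isGδ, dense_iInter_of_isOpen ho fun p =>
    dense_uniformVisit hTM hM hT (lt_add_of_pos_right 1 (by positivity)) _
      (isOpen_of_mem_countableBasis p.2.2) (nonempty_of_mem_countableBasis p.2.2)⟩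

end Abstract

/-! ### Radial means of functions of the Hardy space -/

/-- Parseval on the circle of radius `r`, written with a real angle to match the radial limits in
`IsInner`. -/
theorem tsum_norm_sq_eq_integral {d : ℕ → ℂ} {r : ℝ} (hr : 0 ≤ r)
    (hd : Summable fun n => ‖d n‖ * r ^ n) :
    ∑' n, ‖d n * (r : ℂ) ^ n‖ ^ 2 = (2 * Real.pi)⁻¹ *
      ∫ θ in Set.Ioc 0 (2 * Real.pi), ‖∑' n, d n * (r * exp (θ * I)) ^ n‖ ^ 2 := by
  have hd' : Summable fun n => ‖d n * (r : ℂ) ^ n‖ := by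
    simpa [abs_of_nonneg hr] using hd
  have hs : Summable (fun n : ℕ =>
      (d n * (r : ℂ) ^ n) • fourier (T := 2 * Real.pi) (n : ℤ)) :=
    Summable.of_norm (by simpa [norm_smul, fourier_norm] using hd')
  have hs' : ∀ x, HasSum (fun n : ℕ => (d n * (r : ℂ) ^ n) * fourier (T := 2 * Real.pi) (n : ℤ) x)
      ((∑' n : ℕ, (d n * (r : ℂ) ^ n) • fourier (T := 2 * Real.pi) (n : ℤ)) x) := fun x =>
    hs.hasSum.mapL (ContinuousMap.evalCLM ℂ x)
  rw [(parseval_of_summable hd' _ hs').tsum_eq, AddCircle.integral_haarAddCircle,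
    ← AddCircle.integral_preimage (2 * Real.pi) 0, zero_add, smul_eq_mul]
  congr 2
  funext θ
  rw [← (hs' θ).tsum_eq]
  congr 2
  refine tsum_congr fun n => ?_
  rw [fourier_coe_apply, mul_pow, ← mul_assoc, ← Complex.exp_nat_mul]
  congr 2
  have : (Real.pi : ℂ) ≠ 0 := by exact_mod_cast Real.pi_ne_zero
  push_cast
  field_simp

theorem norm_mul_exp_mul_I {r : ℝ} (hr : 0 ≤ r) (θ : ℝ) : ‖(r : ℂ) * exp (θ * I)‖ = r := by
  rw [norm_mul, Complex.norm_exp_ofReal_mul_I, mul_one, Complex.norm_real, Real.norm_of_nonneg hr]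

theorem EllTwo.tendsto_tsum_norm_sq (a : EllTwo) :
    Tendsto (fun r : ℝ => ∑' n, ‖a n * (r : ℂ) ^ n‖ ^ 2) (𝓝[<] 1) (𝓝 (‖a‖ ^ 2)) := by
  rw [a.norm_sq]
  refine tendsto_tsum_of_dominated_convergence a.summable (fun n => ?_) ?_
  · have hc : Continuous fun r : ℝ => ‖a n * (r : ℂ) ^ n‖ ^ 2 := by fun_prop
    simpa using (hc.tendsto 1).mono_left nhdsWithin_le_nhds
  · filter_upwards [Ioo_mem_nhdsLT (zero_lt_one (α := ℝ))] with r hr n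
    rw [Real.norm_of_nonneg (by positivity), norm_mul, norm_pow, Complex.norm_real,
      Real.norm_of_nonneg hr.1.le]
    exact pow_le_pow_left₀ (mul_nonneg (norm_nonneg _) (pow_nonneg hr.1.le n))
      (mul_le_of_le_one_right (norm_nonneg _) (pow_le_one₀ hr.1.le hr.2.le)) 2

/-- The norm of a bounded function of the Hardy space in terms of the moduli of its radial
limits. -/
theorem EllTwo.norm_sq_eq_integral_of_tendsto (a : EllTwo) {C : ℝ}
    (hC : ∀ z : ℂ, ‖z‖ < 1 → ‖∑' n, a n * z ^ n‖ ≤ C) {l : ℝ → ℝ}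
    (hl : ∀ᵐ θ : ℝ, Tendsto (fun r : ℝ => ‖∑' n, a n * (r * exp (θ * I)) ^ n‖) (𝓝[<] 1)
      (𝓝 (l θ))) :
    ‖a‖ ^ 2 = (2 * Real.pi)⁻¹ * ∫ θ in Set.Ioc 0 (2 * Real.pi), l θ ^ 2 := by
  have hr : ∀ᶠ r : ℝ in 𝓝[<] 1, r ∈ Set.Ioo (0 : ℝ) 1 := Ioo_mem_nhdsLT zero_lt_one
  have hball : ∀ r ∈ Set.Ioo (0 : ℝ) 1, ∀ θ : ℝ, ‖(r : ℂ) * exp (θ * I)‖ < 1 := fun r hr θ => by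
    rw [norm_mul_exp_mul_I hr.1.le]
    exact hr.2
  -- Both sides are limits, as `r → 1`, of the mean square on the circle of radius `r`; the bound
  -- `C` provides domination.
  refine tendsto_nhds_unique a.tendsto_tsum_norm_sq (Tendsto.congr' ?_ (Tendsto.const_mul _
    (tendsto_integral_filter_of_dominated_convergence (fun _ => C ^ 2) (F := fun (r : ℝ) (θ : ℝ) =>
      ‖∑' n, a n * (r * exp (θ * I)) ^ n‖ ^ 2) ?_ ?_ ?_ ?_)))
  · filter_upwards [hr] with r hr
    exact (tsum_norm_sq_eq_integral hr.1.le (a.summable_mul_pow hr.1.le hr.2)).symm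
  · filter_upwards [hr] with r hr
    have hc : Continuous fun θ : ℝ => ∑' n, a n * (r * exp (θ * I)) ^ n :=
      a.differentiableOn_powerSeries.continuousOn.comp_continuous
        (f := fun θ : ℝ => (r : ℂ) * exp (θ * I)) (by fun_prop)
        fun θ => by simpa using hball r hr θ
    exact (hc.norm.pow 2).aestronglyMeasurable
  · filter_upwards [hr] with r hr
    refine ae_of_all _ fun θ => ?_
    rw [Real.norm_of_nonneg (by positivity)]
    exact pow_le_pow_left₀ (norm_nonneg _) (hC _ (hball r hr θ)) 2
  · exact integrable_const _
  · filter_upwards [ae_restrict_of_ae hl] with θ hθ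
    exact hθ.pow 2

namespace HardySpace

theorem powerSeries_taylor (f : HardySpace) {z : ℂ} (hz : ‖z‖ < 1) :
    ∑' n, taylor f n * z ^ n = f (UnitDisc.mk z hz) :=
  (hasSum_taylor f (UnitDisc.mk z hz)).tsum_eq

/-- Point evaluations are bounded. The constant is not sharp, but only its independence of `f` is
used. -/
theorem norm_apply_le (f : HardySpace) (z : 𝔻) : ‖f z‖ ≤ ‖f‖ * (1 - ‖(z : ℂ)‖)⁻¹ := by
  rw [← (hasSum_taylor f z).tsum_eq, ← tsum_geometric_of_lt_one (norm_nonneg _) z.norm_lt_one,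
    ← tsum_mul_left]
  refine tsum_of_norm_bounded ((summable_geometric_of_lt_one (norm_nonneg _)
    z.norm_lt_one).mul_left _).hasSum fun n => ?_
  rw [norm_mul, norm_pow]
  exact mul_le_mul_of_nonneg_right ((taylor f).norm_coeff_le n) (by positivity)

/-- The partial sums of the Taylor series. -/
noncomputable def partialSum (f : HardySpace) (s : Finset ℕ) : HardySpace :=
  taylorIsometry.symm (∑ i ∈ s, lp.single 2 i (taylor f i))

theorem tendsto_partialSum (f : HardySpace) : Tendsto f.partialSum atTop (𝓝 f) := by
  have h : HasSum (fun i => lp.single 2 i (taylor f i)) (taylor f) :=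
    lp.hasSum_single (by simp) (taylor f)
  have h2 := (taylorIsometry.symm.continuous.tendsto _).comp h
  rwa [show taylorIsometry.symm (taylor f) = f from taylorIsometry.symm_apply_apply f] at h2

theorem taylor_partialSum (f : HardySpace) (s : Finset ℕ) (n : ℕ) :
    taylor (f.partialSum s) n = if n ∈ s then taylor f n else 0 := by
  have h : taylor (f.partialSum s) = ∑ i ∈ s, lp.single 2 i (taylor f i) :=
    taylorIsometry.apply_symm_apply _
  rw [h, lp.coeFn_sum, Finset.sum_apply]
  simp [lp.single_apply, Pi.single_apply]

theorem powerSeries_partialSum (f : HardySpace) (s : Finset ℕ) (z : ℂ) :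
    ∑' n, taylor (f.partialSum s) n * z ^ n = ∑ n ∈ s, taylor f n * z ^ n := by
  rw [tsum_eq_sum (s := s) fun n hn => by simp [taylor_partialSum, hn]]
  exact Finset.sum_congr rfl fun n hn => by simp [taylor_partialSum, hn]

instance : SecondCountableTopology HardySpace := by
  have hsep : TopologicalSpace.SeparableSpace HardySpace := by
    rw [← TopologicalSpace.isSeparable_univ_iff]
    refine ((Set.countable_range fun i : ℕ => (taylorIsometry.symm
      (lp.single 2 i (1 : ℂ)) : HardySpace)).isSeparable.span (R := ℂ)).closure.mono fun f _ => ?_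
    refine mem_closure_of_tendsto f.tendsto_partialSum (Eventually.of_forall fun s => ?_)
    rw [partialSum, map_sum]
    refine Submodule.sum_mem _ fun i _ => ?_
    have : lp.single 2 i (taylor f i) = taylor f i • (lp.single 2 i (1 : ℂ) : EllTwo) := by
      rw [← lp.single_smul, smul_eq_mul, mul_one]
    rw [this, map_smul]
    exact Submodule.smul_mem _ _ (Submodule.subset_span ⟨i, rfl⟩)
  exact UniformSpace.secondCountable_of_separable HardySpace

end HardySpace

/-! ### Multiplication by an inner function -/

theorem powerSeries_multiplier {φ : ℂ → ℂ} (hφ : IsBoundedHolomorphic φ) (f : HardySpace) {z : ℂ}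
    (hz : ‖z‖ < 1) :
    ∑' n, HardySpace.taylor (multiplier φ hφ f) n * z ^ n =
      φ z * ∑' n, HardySpace.taylor f n * z ^ n := by
  rw [HardySpace.powerSeries_taylor _ hz, HardySpace.powerSeries_taylor _ hz, multiplier_apply,
    UnitDisc.coe_mk]

theorem multiplier_pow_apply {φ : ℂ → ℂ} (hφ : IsBoundedHolomorphic φ) (f : HardySpace) (n : ℕ)
    (z : 𝔻) : (multiplier φ hφ ^ n) f z = φ z ^ n * f z := by
  induction n with
  | zero => simp
  | succ n ih => rw [pow_succ', mul_apply_eq_comp, multiplier_apply, ih, pow_succ']; ring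

/-- For a polynomial `p`, both `p` and `φ p` are bounded and their radial limits have the same
modulus almost everywhere, so the integral formula gives equal norms. Density of polynomials then
removes the restriction on `f`. -/
theorem IsInner.norm_multiplier_partialSum {φ : ℂ → ℂ} (hφ : IsInner φ) (f : HardySpace)
    (s : Finset ℕ) : ‖multiplier φ hφ.bounded (f.partialSum s)‖ = ‖f.partialSum s‖ := by
  set p : ℂ → ℂ := fun z => ∑ n ∈ s, HardySpace.taylor f n * z ^ n with hp
  have hpc : Continuous p := by fun_prop
  obtain ⟨C, hC⟩ := hφ.bounded.2
  have hC0 : 0 ≤ C := (norm_nonneg _).trans (hC 0 (by simp))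
  set D : ℝ := ∑ n ∈ s, ‖HardySpace.taylor f n‖ with hD
  have hpD : ∀ z : ℂ, ‖z‖ < 1 → ‖p z‖ ≤ D := fun z hz => by
    refine (norm_sum_le _ _).trans (Finset.sum_le_sum fun n _ => ?_)
    rw [norm_mul, norm_pow]
    exact mul_le_of_le_one_right (norm_nonneg _) (pow_le_one₀ (norm_nonneg _) hz.le)
  have hlim : ∀ θ : ℝ, Tendsto (fun r : ℝ => ‖p (r * exp (θ * I))‖) (𝓝[<] 1)
      (𝓝 ‖p (exp (θ * I))‖) := fun θ => by
    have hc : Continuous fun r : ℝ => ‖p (r * exp (θ * I))‖ := by fun_prop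
    simpa using (hc.tendsto 1).mono_left nhdsWithin_le_nhds
  have h1 := (HardySpace.taylor (f.partialSum s)).norm_sq_eq_integral_of_tendsto (C := D)
    (l := fun θ => ‖p (exp (θ * I))‖)
    (fun z hz => by rw [HardySpace.powerSeries_partialSum]; exact hpD z hz)
    (ae_of_all _ fun θ => by simpa only [HardySpace.powerSeries_partialSum] using hlim θ)
  have h2 := (HardySpace.taylor
    (multiplier φ hφ.bounded (f.partialSum s))).norm_sq_eq_integral_of_tendsto (C := C * D)
    (l := fun θ => ‖p (exp (θ * I))‖)
    (fun z hz => by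
      rw [powerSeries_multiplier _ _ hz, HardySpace.powerSeries_partialSum, norm_mul]
      exact mul_le_mul (hC z (by simpa using hz)) (hpD z hz) (norm_nonneg _) hC0)
    (by
      filter_upwards [hφ.radial] with θ ⟨w, hw, hlimw⟩
      have h3 := hlimw.norm.mul (hlim θ)
      rw [hw, one_mul] at h3
      refine h3.congr' ?_
      filter_upwards [Ioo_mem_nhdsLT (zero_lt_one (α := ℝ))] with r hr
      rw [powerSeries_multiplier _ _ (by rw [norm_mul_exp_mul_I hr.1.le]; exact hr.2),
        HardySpace.powerSeries_partialSum, norm_mul])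
  rw [HardySpace.norm_def, HardySpace.norm_def]
  exact (pow_left_inj₀ (norm_nonneg _) (norm_nonneg _) two_ne_zero).1 (h2.trans h1.symm)

/-- Multiplication by an inner function is an isometry of the Hardy space. -/
theorem IsInner.norm_multiplier {φ : ℂ → ℂ} (hφ : IsInner φ) (f : HardySpace) :
    ‖multiplier φ hφ.bounded f‖ = ‖f‖ := by
  have h1 := ((multiplier φ hφ.bounded).continuous.norm.tendsto f).comp f.tendsto_partialSum
  have h2 := (continuous_norm.tendsto f).comp f.tendsto_partialSum
  exact tendsto_nhds_unique (h1.congr fun s => hφ.norm_multiplier_partialSum f s) h2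

theorem IsInner.norm_multiplier_pow {φ : ℂ → ℂ} (hφ : IsInner φ) (n : ℕ) (f : HardySpace) :
    ‖(multiplier φ hφ.bounded ^ n) f‖ = ‖f‖ := by
  induction n with
  | zero => simp
  | succ n ih => rw [pow_succ', mul_apply_eq_comp, hφ.norm_multiplier, ih]

theorem IsInner.adjoint_mul_self {φ : ℂ → ℂ} (hφ : IsInner φ) :
    ContinuousLinearMap.adjoint (multiplier φ hφ.bounded) * multiplier φ hφ.bounded = 1 :=
  (ContinuousLinearMap.norm_map_iff_adjoint_comp_self _).1 hφ.norm_multiplier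

/-- The functions `φ ^ n` all have the norm of the constant `1`, so boundedness of the evaluation at
`z` keeps `|φ z| ^ n` bounded in `n`. No Poisson integral is needed. -/
theorem IsInner.norm_le_one {φ : ℂ → ℂ} (hφ : IsInner φ) (z : 𝔻) : ‖φ z‖ ≤ 1 := by
  by_contra! h
  set e : HardySpace := HardySpace.taylor.symm (lp.single 2 0 1) with he
  have hez : e z = 1 := by
    have h1 := (HardySpace.hasSum_taylor e z).tsum_eq
    rw [he, LinearEquiv.apply_symm_apply, tsum_eq_single 0 fun n hn => by
      rw [lp.single_apply_ne _ _ _ hn, zero_mul]] at h1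
    simpa using h1.symm
  obtain ⟨n, hn⟩ := ((tendsto_pow_atTop_atTop_of_one_lt h).eventually_gt_atTop
    (‖e‖ * (1 - ‖(z : ℂ)‖)⁻¹)).exists
  have h2 := HardySpace.norm_apply_le ((multiplier φ hφ.bounded ^ n) e) z
  rw [multiplier_pow_apply, hez, mul_one, norm_pow, hφ.norm_multiplier_pow] at h2
  exact h2.not_gt hn

/-- Maximum modulus principle: equality at an interior point would make `φ` constant. -/
theorem IsInner.norm_lt_one {φ : ℂ → ℂ} (hφ : IsInner φ)
    (hc : ¬ ∃ c : ℂ, ∀ z ∈ Metric.ball (0 : ℂ) 1, φ z = c) (z : 𝔻) : ‖φ z‖ < 1 := by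
  refine (hφ.norm_le_one z).lt_of_ne fun h => hc ⟨φ z, ?_⟩
  have hz : (z : ℂ) ∈ Metric.ball (0 : ℂ) 1 := by simpa using z.norm_lt_one
  refine Complex.eqOn_of_isPreconnected_of_isMaxOn_norm (convex_ball 0 1).isPreconnected
    Metric.isOpen_ball hφ.bounded.1 hz fun w hw => ?_
  have hw1 : ‖w‖ < 1 := by simpa using hw
  change ‖φ w‖ ≤ ‖φ z‖
  rw [h]
  exact hφ.norm_le_one (UnitDisc.mk w hw1)

/-- An isometry of a Hilbert space without unitary part: its adjoint has dense generalised
kernel. -/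
theorem dense_setOf_adjoint_pow_eq_zero {H : Type*} [NormedAddCommGroup H] [InnerProductSpace ℂ H]
    [CompleteSpace H] {M : H →L[ℂ] H} (hM : ContinuousLinearMap.adjoint M * M = 1)
    (hpure : ∀ v : H, (∀ n : ℕ, ∃ g, v = (M ^ n) g) → v = 0) :
    Dense {x : H | ∃ n, (ContinuousLinearMap.adjoint M ^ n) x = 0} := by
  set T := ContinuousLinearMap.adjoint M with hT
  have hadj : ∀ n (x y : H), inner ℂ ((T ^ n) x) y = inner ℂ x ((M ^ n) y) := by
    intro n
    induction n with
    | zero => simp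
    | succ n ih =>
      intro x y
      rw [pow_succ, pow_succ', mul_apply_eq_comp, ih, mul_apply_eq_comp,
        hT, ContinuousLinearMap.adjoint_inner_left]
  have hdir : Directed (· ≤ ·) fun n : ℕ => (T ^ n).ker :=
    (monotone_nat_of_le_succ fun n x hx => pow_apply_eq_zero_of_le n.le_succ hx).directed_le
  have hset : {x : H | ∃ n, (T ^ n) x = 0} = ((⨆ n : ℕ, (T ^ n).ker : Submodule ℂ H) : Set H) := by
    ext x
    rw [SetLike.mem_coe, Submodule.mem_iSup_of_directed _ hdir]
    rfl
  rw [hset, Submodule.dense_iff_topologicalClosure_eq_top, Submodule.topologicalClosure_eq_top_iff,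
    Submodule.eq_bot_iff]
  refine fun v hv => hpure v fun n => ⟨(T ^ n) v, ?_⟩
  -- `M ^ n T ^ n` projects onto the range of `M ^ n`. The remainder `d` is in the kernel of `T ^
  -- n`, hence orthogonal both to `v` and to that range, hence to itself.
  set d := v - (M ^ n) ((T ^ n) v) with hd
  have hd0 : (T ^ n) d = 0 := by
    rw [hd, map_sub, pow_apply_pow_apply hM le_rfl, Nat.sub_self, pow_zero, one_apply_eq_self,
      sub_self]
  have h1 : inner ℂ d v = 0 :=
    (Submodule.mem_orthogonal _ v).1 hv d (Submodule.mem_iSup_of_mem n hd0)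
  have h2 : inner ℂ d d = 0 := by
    conv_lhs => rw [hd]
    rw [← hd, hd, inner_sub_right, ← hd, h1, ← hadj, hd0, inner_zero_left, sub_zero]
  exact sub_eq_zero.1 (inner_self_eq_zero.1 h2)

/-- If `v = φ ^ n g` then `‖g‖ = ‖v‖`, so `|v z|` is at most `|φ z| ^ n` times a constant
independent of `n`, which tends to `0`. -/
theorem IsInner.eq_zero_of_forall_exists_pow {φ : ℂ → ℂ} (hφ : IsInner φ)
    (hc : ¬ ∃ c : ℂ, ∀ z ∈ Metric.ball (0 : ℂ) 1, φ z = c) (v : HardySpace)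
    (hv : ∀ n : ℕ, ∃ g, v = (multiplier φ hφ.bounded ^ n) g) : v = 0 := by
  refine HardySpace.ext fun z => ?_
  have hlim : Tendsto (fun n : ℕ => ‖φ z‖ ^ n * (‖v‖ * (1 - ‖(z : ℂ)‖)⁻¹)) atTop (𝓝 0) := by
    simpa using (tendsto_pow_atTop_nhds_zero_of_lt_one (norm_nonneg _)
      (hφ.norm_lt_one hc z)).mul_const _
  refine norm_le_zero_iff.1 (ge_of_tendsto' hlim fun n => ?_)
  obtain ⟨g, hg⟩ := hv n
  have hnorm : ‖g‖ = ‖v‖ := by rw [hg, hφ.norm_multiplier_pow]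
  conv_lhs => rw [hg]
  rw [multiplier_pow_apply, norm_mul, norm_pow, ← hnorm]
  exact mul_le_mul_of_nonneg_left (g.norm_apply_le z) (by positivity)

theorem IsInner.isGδ_and_dense {φ : ℂ → ℂ} (hφ : IsInner φ)
    (hc : ¬ ∃ c : ℂ, ∀ z ∈ Metric.ball (0 : ℂ) 1, φ z = c) :
    IsGδ (⋂ (lam : ℝ) (_ : 1 < lam), hypercyclicVectors
        ((lam : ℂ) • ContinuousLinearMap.adjoint (multiplier φ hφ.bounded))) ∧
      Dense (⋂ (lam : ℝ) (_ : 1 < lam), hypercyclicVectors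
        ((lam : ℂ) • ContinuousLinearMap.adjoint (multiplier φ hφ.bounded))) :=
  isGδ_and_dense_iInter_hypercyclicVectors hφ.adjoint_mul_self
    (fun f => (hφ.norm_multiplier f).le)
    (dense_setOf_adjoint_pow_eq_zero hφ.adjoint_mul_self (hφ.eq_zero_of_forall_exists_pow hc))

/-! ### The identity function and the backward shift -/

theorem isInner_id : IsInner fun z => z where
  bounded := ⟨differentiableOn_id, 1, fun z hz => by simpa using (mem_ball_zero_iff.1 hz).le⟩
  radial := ae_of_all _ fun θ => ⟨exp (θ * I), Complex.norm_exp_ofReal_mul_I θ, by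
    have hc : Continuous fun r : ℝ => (r : ℂ) * exp (θ * I) := by fun_prop
    simpa using (hc.tendsto 1).mono_left nhdsWithin_le_nhds⟩

theorem not_exists_id_eq_const : ¬ ∃ c : ℂ, ∀ z ∈ Metric.ball (0 : ℂ) 1, z = c := by
  rintro ⟨c, hc⟩
  have h1 := hc 0 (by simp)
  have h2 := hc (1 / 2) (by simp; norm_num)
  rw [← h1] at h2
  norm_num at h2

/-- The forward shift of a square summable sequence. -/
def EllTwo.shift (a : EllTwo) : EllTwo :=
  ⟨fun n => if n = 0 then 0 else a (n - 1), EllTwo.memlp ((summable_nat_add_iff 1).1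
    (a.summable.congr fun n => by rw [if_neg n.succ_ne_zero, Nat.add_sub_cancel]))⟩

theorem EllTwo.shift_zero (a : EllTwo) : a.shift 0 = 0 := rfl

theorem EllTwo.shift_succ (a : EllTwo) (n : ℕ) : a.shift (n + 1) = a n := rfl

theorem taylor_multiplier_id (h : IsBoundedHolomorphic fun z => z) (f : HardySpace) :
    HardySpace.taylor (multiplier (fun z => z) h f) = (HardySpace.taylor f).shift := by
  refine HardySpace.coeff_unique fun z => ?_
  rw [(HardySpace.hasSum_taylor _ z).tsum_eq,
    ((HardySpace.taylor f).shift.summable_powerSeries z.norm_lt_one).tsum_eq_zero_add,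
    multiplier_apply, ← (HardySpace.hasSum_taylor f z).tsum_eq, ← tsum_mul_left]
  rw [EllTwo.shift_zero, zero_mul, zero_add]
  exact tsum_congr fun n => by rw [EllTwo.shift_succ]; ring

theorem inner_backwardShift (a b : EllTwo) : inner ℂ (backwardShift a) b = inner ℂ a b.shift := by
  rw [lp.inner_eq_tsum, lp.inner_eq_tsum, (lp.summable_inner (𝕜 := ℂ) a b.shift).tsum_eq_zero_add]
  rw [EllTwo.shift_zero, inner_zero_right, zero_add]
  exact tsum_congr fun n => by rw [EllTwo.shift_succ, backwardShift_apply]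

/-- Multiplication by `z` is the forward shift on coefficients, and the backward shift is the
adjoint of the forward one. -/
theorem taylorIsometry_adjoint_multiplier_id (h : IsBoundedHolomorphic fun z => z)
    (f : HardySpace) :
    HardySpace.taylorIsometry (ContinuousLinearMap.adjoint (multiplier (fun z => z) h) f) =
      backwardShift (HardySpace.taylorIsometry f) := by
  refine ext_inner_right ℂ fun b => ?_
  obtain ⟨g, rfl⟩ := HardySpace.taylorIsometry.surjective b
  rw [inner_backwardShift, LinearIsometryEquiv.inner_map_map,
    ContinuousLinearMap.adjoint_inner_left, HardySpace.inner_def, taylor_multiplier_id]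
  rfl

theorem mem_hypercyclicVectors_of_semiconj {X Y : Type*} [AddCommGroup X] [Module ℂ X]
    [TopologicalSpace X] [AddCommGroup Y] [Module ℂ Y] [TopologicalSpace Y] {T : X →L[ℂ] X}
    {S : Y →L[ℂ] Y} {u : X → Y} (hu : Continuous u) (hd : DenseRange u)
    (h : ∀ x, u (T x) = S (u x)) {x : X} (hx : x ∈ hypercyclicVectors T) :
    u x ∈ hypercyclicVectors S := by
  have hpow : ∀ n, u ((T ^ n) x) = (S ^ n) (u x) := by
    intro n
    induction n with
    | zero => simp
    | succ n ih => rw [pow_succ', mul_apply_eq_comp, h, ih, pow_succ', mul_apply_eq_comp]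
  refine (hd.dense_image hu hx).mono ?_
  rintro _ ⟨_, ⟨n, hn, rfl⟩, rfl⟩
  exact ⟨n, hn, hpow n⟩

theorem exists_common_hypercyclicVector_backwardShift :
    ∃ x : EllTwo, ∀ lam : ℝ, 1 < lam → x ∈ hypercyclicVectors ((lam : ℂ) • backwardShift) := by
  obtain ⟨f, hf⟩ := (isInner_id.isGδ_and_dense not_exists_id_eq_const).2.nonempty
  refine ⟨HardySpace.taylorIsometry f, fun lam hlam => ?_⟩
  refine mem_hypercyclicVectors_of_semiconj HardySpace.taylorIsometry.continuous
    HardySpace.taylorIsometry.surjective.denseRange (fun g => ?_) (Set.mem_iInter₂.1 hf lam hlam)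
  rw [smul_apply, smul_apply, map_smul, taylorIsometry_adjoint_multiplier_id]

theorem mainTheorem4 :
    (∀ (φ : ℂ → ℂ) (hφ : IsInner φ),
      (¬ ∃ c : ℂ, ∀ z ∈ Metric.ball (0 : ℂ) 1, φ z = c) →
      (⋂ (lam : ℝ) (_ : 1 < lam), hypercyclicVectors
          ((lam : ℂ) • ContinuousLinearMap.adjoint (multiplier φ hφ.bounded)))
        ∈ residual HardySpace ∧
      IsGδ (⋂ (lam : ℝ) (_ : 1 < lam), hypercyclicVectors
          ((lam : ℂ) • ContinuousLinearMap.adjoint (multiplier φ hφ.bounded))) ∧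
      Dense (⋂ (lam : ℝ) (_ : 1 < lam), hypercyclicVectors
          ((lam : ℂ) • ContinuousLinearMap.adjoint (multiplier φ hφ.bounded)))) ∧
    (∃ h : IsInner (fun z => z), ∀ f : HardySpace,
      HardySpace.taylorIsometry
          (ContinuousLinearMap.adjoint (multiplier (fun z => z) h.bounded) f) =
        backwardShift (HardySpace.taylorIsometry f)) ∧
    (∃ x : EllTwo, ∀ lam : ℝ, 1 < lam →
      x ∈ hypercyclicVectors ((lam : ℂ) • backwardShift)) := by
  refine ⟨fun φ hφ hc => ?_, ⟨isInner_id, taylorIsometry_adjoint_multiplier_id _⟩,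
    exists_common_hypercyclicVector_backwardShift⟩
  obtain ⟨hG, hd⟩ := hφ.isGδ_and_dense hc
  exact ⟨residual_of_dense_Gδ hG hd, hG, hd⟩
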